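/- **Theorem 5.3.** Let $\Sigma$ be a finite alphabet. *Automata.* The input tape holds $\#w\#$, with $\#\notin\Sigma$ as the end-marker on both sides, for $w\in\Sigma^*$. All heads are read-only, start on the left end-marker, and in each step either stay put or move one square to the right; they never leave the tape (an instruction to move right on the right end-marker leaves the head in place). A 1nfa($k$) is a nondeterministic finite automaton with $k$ such heads: depending on its state and the $k$ scanned symbols it chooses among finitely many pairs of a new state and a tuple of head moves, and it accepts $w$ if some computation from the start state reaches an accepting state. $\mathsf{1NFA}(k)$ is the class of languages over $\Sigma$ recognized by 1nfa($k$)'s. *Verifiers.* A $k$-head one-way verifier $V$ is a finite automaton with $k$ such heads whose states are coin-tossing states, deterministic states, an accepting and a rejecting halting state; the start state is non-halting. It has a finite communication alphabet $\Gamma$ with a null symbol $\epsilon$, and each non-halting state $q$ has a symbol $\gamma_q\in\Gamma$. Each time $V$ is about to make a move from a non-halting state $q$ with $\gamma_q\ne\epsilon$, it sends $\gamma_q$ to the prover and receives a response in $\Gamma$; if $\gamma_q=\epsilon$ there is no communication and the symbol received is taken to be $\epsilon$. The move (new state and head moves) is determined by $q$, the $k$ scanned symbols, the symbol received and, if $q$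 is coin-tossing, a fresh fair random bit. A (two-way) prover is a function that determines each response from the input and the entire communication so far, including the symbol just sent. A one-way prover assigns to each input an infinite sequence over $\Gamma$, whose $i$-th symbol is the response in the $i$-th communication step. $V$ uses constantly many random bits if there is an $r$ such that on all inputs, against all provers and for all outcomes of the coin tosses, $V$ tosses at most $r$ coins. *Proof systems.* Under two-way (respectively one-way) communication, all provers are two-way (respectively one-way). $V$ verifies $L\subseteq\Sigma^*$ with error $\varepsilon$ if 1. there is a prover $P$ such that for every $w\in L$ the interaction of $P$ and $V$ on $w$ ends in acceptance with probability at least $1-\varepsilon$; and 2. for every $w\notin L$ and every prover $P^*$, the interaction of $P^*$ and $V$ on $w$ ends in rejection with probability at least $1-\varepsilon$ (strong definition), respectively in acceptance with probability at most $\varepsilon$ (weak definition). *Claim.* For each of the four combinations of strong or weak definition and one-way or two-way communication, the class of languages $L\subseteq\Sigma^*$ that are verified, with some error $0\le\varepsilon<\frac12$, by some $k$-head one-way verifier ($k\ge 1$) that uses constantly many random bits is exactly $$\bigcup_{k\ge 1}\mathsf{1NFA}(k).$$ -/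

import Mathlib

open MeasureTheory

namespace MultiheadVerifier

/-! ### Input tape and one-way heads -/

/-- The input tape `¢ w ¢`: squares `0` and `w.length + 1` hold the end-marker `¢`
(written `none`), and square `i + 1` holds the `i`-th letter of `w`. -/
def tape {α : Type*} (w : List α) : ℕ → Option α
  | 0 => none
  | i + 1 => w[i]?

/-- The tuple of symbols scanned by `k` heads. -/
def scan {α : Type*} {k : ℕ} (w : List α) (p : Fin k → ℕ) : Fin k → Option α :=
  fun i => tape w (p i)

/-- Head `i` moves by `d i ∈ {0, +1}`.  Heads do not leave the tape: an instruction to move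
right on the right end-marker leaves the head where it is. -/
def move {α : Type*} {k : ℕ} (w : List α) (p : Fin k → ℕ) (d : Fin k → Fin 2) : Fin k → ℕ :=
  fun i => min (p i + (d i : ℕ)) (w.length + 1)

/-! ### Nondeterministic one-way multihead finite automata -/

/-- A `1nfa(k)`: a nondeterministic finite automaton with `k` one-way heads. -/
structure OneWayNFA (α : Type*) (k : ℕ) where
  Q : Type
  [finQ : Finite Q]
  start : Q
  accept : Set Q
  δ : Q → (Fin k → Option α) → Set (Q × (Fin k → Fin 2))

namespace OneWayNFA

variable {α : Type*} {k : ℕ} (M : OneWayNFA α k)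

/-- One computation step on input `w`; a configuration is a state with the head positions. -/
def Step (w : List α) (c c' : M.Q × (Fin k → ℕ)) : Prop :=
  ∃ d : Fin k → Fin 2, (c'.1, d) ∈ M.δ c.1 (scan w c.2) ∧ c'.2 = move w c.2 d

/-- `w` is accepted if some computation that starts in the start state, with all heads on the
left end-marker, reaches an accepting state. -/
def language : Language α :=
  {w | ∃ q ∈ M.accept, ∃ p : Fin k → ℕ,
    Relation.ReflTransGen (M.Step w) (M.start, fun _ => 0) (q, p)}

end OneWayNFA

/-- The class `1NFA(k)` of languages over `α`. -/
def classOneNFA (α : Type*) (k : ℕ) : Set (Language α) :=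
  {L | ∃ M : OneWayNFA α k, M.language = L}

/-! ### Verifiers -/

/-- The states of a verifier: coin-tossing states `R`, deterministic states `D`, and the two
halting states. -/
inductive VState (R D : Type) : Type
  | coin (q : R)
  | det (q : D)
  | accept
  | reject

/-- A probabilistic finite automaton with `k` one-way heads, as a verifier.  `Γ` is the
communication alphabet, with its null symbol; `msg q` is the communication symbol of the
non-halting state `q`. The arguments of the transition functions are the state, the scanned
symbols, the content of the communication cell and, in coin-tossing states, the random bit. -/
structure Verifier (α : Type*) (k : ℕ) where
  R : Type
  D : Type
  Γ : Type
  [finR : Finite R]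
  [finD : Finite D]
  [finΓ : Finite Γ]
  null : Γ
  start : R ⊕ D
  msg : R ⊕ D → Γ
  δcoin : R → (Fin k → Option α) → Γ → Bool → VState R D × (Fin k → Fin 2)
  δdet : D → (Fin k → Option α) → Γ → VState R D × (Fin k → Fin 2)

/-- A prover: from the input string, the communication so far (the list, oldest first, of the
pairs of a symbol sent by the verifier and the response to it) and the symbol just sent by the
verifier, it determines the response. -/
abbrev Prover (α : Type*) (Γ : Type) : Type _ :=
  List α → List (Γ × Γ) → Γ → Γ

/-- A one-way prover maps each input string to a sequence of symbols; its response in the `i`-th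
communication step is the `i`-th symbol of that sequence. -/
def Prover.IsOneWay {α : Type*} {Γ : Type} (P : Prover α Γ) : Prop :=
  ∃ c : List α → ℕ → Γ, ∀ w h s, P w h s = c w h.length

namespace Verifier

variable {α : Type*} {k : ℕ} (V : Verifier α k)

/-- A snapshot of an interaction: the state and head positions of the verifier, the number of
coins tossed so far, and the communication so far. -/
structure Snapshot where
  state : VState V.R V.D
  heads : Fin k → ℕ
  tossed : ℕ
  history : List (V.Γ × V.Γ)

/-- The snapshot at the start: all heads are on the left end-marker. -/
def init : V.Snapshot where
  state := Sum.elim VState.coin VState.det V.start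
  heads := fun _ => 0
  tossed := 0
  history := []

open Classical in
/-- The symbol read by the verifier from the communication cell in the non-halting state `q`,
and the updated communication.  If the communication symbol of `q` is the null symbol, there is
no communication (and the null symbol is read). -/
noncomputable def communicate (P : Prover α V.Γ) (w : List α) (h : List (V.Γ × V.Γ))
    (q : V.R ⊕ V.D) : V.Γ × List (V.Γ × V.Γ) :=
  if V.msg q = V.null then (V.null, h)
  else (P w h (V.msg q), h ++ [(V.msg q, P w h (V.msg q))])

/-- One step of the interaction with the prover `P` on input `w`, where the `j`-th coin toss
(counted from `0`) gives the bit `β j`. Halting states are never left. -/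
noncomputable def step (P : Prover α V.Γ) (w : List α) (β : ℕ → Bool) (c : V.Snapshot) :
    V.Snapshot :=
  match c.state with
  | .accept => c
  | .reject => c
  | .coin q =>
      let m := V.communicate P w c.history (Sum.inl q)
      let t := V.δcoin q (scan w c.heads) m.1 (β c.tossed)
      { state := t.1
        heads := move w c.heads t.2
        tossed := c.tossed + 1
        history := m.2 }
  | .det q =>
      let m := V.communicate P w c.history (Sum.inr q)
      let t := V.δdet q (scan w c.heads) m.1
      { state := t.1
        heads := move w c.heads t.2
        tossed := c.tossed
        history := m.2 }

/-- The snapshot after `n` steps. -/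
noncomputable def run (P : Prover α V.Γ) (w : List α) (β : ℕ → Bool) (n : ℕ) : V.Snapshot :=
  (V.step P w β)^[n] V.init

/-- The verifier never tosses more than `r` coins, on any input, against any prover, and for any
outcome of the coin tosses. -/
def UsesAtMost (r : ℕ) : Prop :=
  ∀ (w : List α) (P : Prover α V.Γ) (β : ℕ → Bool) (n : ℕ), (V.run P w β n).tossed ≤ r

end Verifier

/-- The law of a sequence of independent fair coin tosses. -/
noncomputable def coinMeasure : Measure (ℕ → Bool) :=
  Measure.infinitePi fun _ => (PMF.uniformOfFintype Bool).toMeasure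

namespace Verifier

variable {α : Type*} {k : ℕ} (V : Verifier α k)

/-- The probability that the interaction of `P` and `V` on `w` results in acceptance. -/
noncomputable def acceptProb (P : Prover α V.Γ) (w : List α) : ℝ :=
  coinMeasure.real {β | ∃ n, (V.run P w β n).state = .accept}

/-- The probability that the interaction of `P` and `V` on `w` results in rejection. -/
noncomputable def rejectProb (P : Prover α V.Γ) (w : List α) : ℝ :=
  coinMeasure.real {β | ∃ n, (V.run P w β n).state = .reject}

end Verifier

/-! ### Interactive proof systems -/

/-- The direction of communication: only from the prover to the verifier, or both ways. -/
inductive Communication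
  | oneWay
  | twoWay

/-- The strong and the weak definition of an interactive proof system. -/
inductive Criterion
  | strong
  | weak

/-- The provers that take part in the given kind of communication. -/
def Communication.provers (comm : Communication) (α : Type*) (Γ : Type) : Set (Prover α Γ) :=
  match comm with
  | .oneWay => {P | P.IsOneWay}
  | .twoWay => Set.univ

/-- What is required on an input outside the language, against a given prover: rejection with
probability at least `1 - ε` (strong), or acceptance with probability at most `ε` (weak). -/
def Criterion.Sound (crit : Criterion) {α : Type*} {k : ℕ} (V : Verifier α k) (ε : ℝ)
    (P : Prover α V.Γ) (w : List α) : Prop :=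
  match crit with
  | .strong => 1 - ε ≤ V.rejectProb P w
  | .weak => V.acceptProb P w ≤ ε

/-- `V`, together with some prover, is an interactive proof system for `L` with error
probability `ε`. -/
def IsProofSystem (comm : Communication) (crit : Criterion) {α : Type*} {k : ℕ}
    (V : Verifier α k) (L : Language α) (ε : ℝ) : Prop :=
  (∃ P ∈ comm.provers α V.Γ, ∀ w ∈ L, 1 - ε ≤ V.acceptProb P w) ∧
  (∀ w ∉ L, ∀ P ∈ comm.provers α V.Γ, crit.Sound V ε P w)

/-- The languages over `α` that have an interactive proof system, of the given kind and with an
error probability `ε < 1/2`, whose verifier is a finite automaton with `k ≥ 1` one-way heads that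
uses at most a constant number `r` of random bits. -/
def verifiable (comm : Communication) (crit : Criterion) (α : Type*) : Set (Language α) :=
  {L | ∃ k : ℕ, 1 ≤ k ∧ ∃ (V : Verifier α k) (r : ℕ), V.UsesAtMost r ∧
    ∃ ε : ℝ, 0 ≤ ε ∧ ε < 1 / 2 ∧ IsProofSystem comm crit V L ε}

end MultiheadVerifier

namespace MultiheadVerifier

/-! ### From automata to verifiers -/

/-! An automaton becomes a coinless verifier, with error 0, by letting the prover dictate the
transitions. The strong definition also requires that every interaction outside the language halts,
although the automaton may loop with its heads at rest. So the verifier itself resolves series of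
transitions that move no head, a finite reachability question, and insists that each dictated
transition move one. The sum of the head positions then bounds the running time (`guided_halts`).
Since the verifier is deterministic given the responses, an accepting computation can be committed
to in advance as a response sequence (`exists_responses`), so a one-way prover suffices.

Conversely, if at most `r` coins are tossed, an automaton with `k * 2 ^ (r + 1)` heads simulates the
verifier on all coin strings at once, guesses the responses, and accepts when more than half of the
simulations have accepted. The guesses must come from one prover. Whole histories do not fit into a
finite state, but it is enough to keep the running simulations at the same number of communication
steps and to remember which pairs have had equal histories. A simulation may wander silently
forever, so the automaton may abandon silent ones; this can only lose acceptances.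
`exists_represents` turns each computation into a prover, `exists_computation` follows a given
prover, and `ε < 1/2` separates the two cases. The strong criterion implies the weak one, so only
acceptance probabilities matter. -/

theorem tape_eq_none_iff {α : Type*} {w : List α} {n : ℕ} (hn : n ≤ w.length + 1) :
    tape w n = none ↔ n = 0 ∨ n = w.length + 1 := by
  cases n with
  | zero => simp [tape]
  | succ n => simp only [tape, List.getElem?_eq_none_iff]; omega

theorem move_le {α : Type*} {k : ℕ} (w : List α) (p : Fin k → ℕ) (d : Fin k → Fin 2) (i : Fin k) :
    move w p d i ≤ w.length + 1 := min_le_right _ _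

/-- Which heads have left the left end-marker. -/
def departed {k : ℕ} (p : Fin k → ℕ) : Fin k → Bool := fun i => decide (p i ≠ 0)

theorem departed_eq_true_iff {k : ℕ} {p : Fin k → ℕ} {i : Fin k} :
    departed p i = true ↔ p i ≠ 0 := decide_eq_true_iff

/-- The tape has at least two squares, so a head told to leave the left end-marker does leave it.
The mask can thus be updated from the instruction alone, in finite memory. -/
theorem departed_move {α : Type*} {k : ℕ} (w : List α) (p : Fin k → ℕ) (d : Fin k → Fin 2) :
    departed (move w p d) = fun i => departed p i || decide (d i = 1) := by
  funext i
  have h : ∀ x : Fin 2, x = 1 ↔ (x : ℕ) ≠ 0 := by decide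
  rw [Bool.eq_iff_iff]
  simp only [departed_eq_true_iff, move, Bool.or_eq_true, decide_eq_true_iff, h]
  omega

/-- The instruction `d` moves no head, if `m` tells which heads have left the left end-marker and
`s` is the tuple of scanned symbols. -/
def Idle {α : Type*} {k : ℕ} (m : Fin k → Bool) (s : Fin k → Option α) (d : Fin k → Fin 2) : Prop :=
  ∀ i, d i = 0 ∨ (m i = true ∧ s i = none)

/-- Both end-markers read `none`; the mask tells them apart, and only on the right one is a move to
the right void. -/
theorem idle_iff {α : Type*} {k : ℕ} {w : List α} {p : Fin k → ℕ} (hp : ∀ i, p i ≤ w.length + 1)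
    (d : Fin k → Fin 2) : Idle (departed p) (scan w p) d ↔ move w p d = p := by
  rw [funext_iff]
  refine forall_congr' fun i => ?_
  have h : ∀ x : Fin 2, x = 0 ↔ (x : ℕ) = 0 := by decide
  have := hp i
  simp only [departed, move, scan, tape_eq_none_iff this, decide_eq_true_eq, h]
  omega

/-! ### The verifier guided by dictated transitions -/

namespace OneWayNFA

attribute [instance] OneWayNFA.finQ

variable {α : Type*} {k : ℕ} (M : OneWayNFA α k)

/-- A transition that moves no head. -/
def IdleStep (m : Fin k → Bool) (s : Fin k → Option α) (q q' : M.Q) : Prop :=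
  ∃ d, Idle m s d ∧ (q', d) ∈ M.δ q s

open Classical in
/-- The coinless verifier that simulates `M` on the transitions that the prover dictates. In one
step it performs a series of idle transitions of its own choice, followed by the dictated
transition, which has to move a head. -/
noncomputable def guided : Verifier α k where
  R := Empty
  D := M.Q × (Fin k → Bool)
  Γ := Option (M.Q × (Fin k → Fin 2))
  null := none
  start := Sum.inr (M.start, fun _ => false)
  -- Any non-null symbol serves: every step in a running state becomes a communication step.
  msg _ := some (M.start, 0)
  δcoin q := q.elim
  δdet q s g :=
    if ∃ a ∈ M.accept, Relation.ReflTransGen (M.IdleStep q.2 s) q.1 a then (.accept, 0)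
    else match g with
      | none => (.reject, 0)
      | some t =>
        if ¬ Idle q.2 s t.2 ∧
            ∃ q', Relation.ReflTransGen (M.IdleStep q.2 s) q.1 q' ∧ t ∈ M.δ q' s then
          (.det (t.1, fun i => q.2 i || decide (t.2 i = 1)), t.2)
        else (.reject, 0)

variable {M}

theorem reachable_of_idle {w : List α} {p : Fin k → ℕ} (hp : ∀ i, p i ≤ w.length + 1) {q q' : M.Q}
    (h : Relation.ReflTransGen (M.IdleStep (departed p) (scan w p)) q q') :
    Relation.ReflTransGen (M.Step w) (q, p) (q', p) :=
  Relation.ReflTransGen.lift (r := M.IdleStep (departed p) (scan w p)) (p := M.Step w)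
    (fun q => (q, p)) (fun _ _ ⟨d, hd, hδ⟩ => ⟨d, hδ, ((idle_iff hp d).1 hd).symm⟩) _ _ h

/-- What holds of the snapshots of an interaction with `M.guided`. -/
def GuidedInv (M : OneWayNFA α k) (w : List α) (c : M.guided.Snapshot) : Prop :=
  c.tossed = 0 ∧
  match c.state with
  | .coin _ => False
  | .det q => (∀ i, c.heads i ≤ w.length + 1) ∧ q.2 = departed c.heads ∧
      Relation.ReflTransGen (M.Step w) (M.start, fun _ => 0) (q.1, c.heads)
  | .accept => w ∈ M.language
  | .reject => True

theorem guided_step_of_det (P : Prover α M.guided.Γ) (w : List α) (β : ℕ → Bool)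
    (c : M.guided.Snapshot) (q : M.guided.D) (hc : c.state = .det q) :
    M.guided.step P w β c =
      { state := (M.guided.δdet q (scan w c.heads) (P w c.history (M.guided.msg (Sum.inr q)))).1
        heads := move w c.heads
          (M.guided.δdet q (scan w c.heads) (P w c.history (M.guided.msg (Sum.inr q)))).2
        tossed := c.tossed
        history := c.history ++
          [(M.guided.msg (Sum.inr q), P w c.history (M.guided.msg (Sum.inr q)))] } := by
  have : M.guided.communicate P w c.history (Sum.inr q) =
      (P w c.history (M.guided.msg (Sum.inr q)),
        c.history ++ [(M.guided.msg (Sum.inr q), P w c.history (M.guided.msg (Sum.inr q)))]) :=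
    if_neg (Option.some_ne_none _)
  simp only [Verifier.step, hc, this]

theorem move_mono {w : List α} {p : Fin k → ℕ} (hp : ∀ i, p i ≤ w.length + 1)
    (d : Fin k → Fin 2) : p ≤ move w p d := fun i => le_min (Nat.le_add_right _ _) (hp i)

/-- A step of the guided verifier preserves the invariant; it halts or moves a head. -/
theorem guided_step (P : Prover α M.guided.Γ) (w : List α) (β : ℕ → Bool)
    (c : M.guided.Snapshot) (hc : M.GuidedInv w c) :
    M.GuidedInv w (M.guided.step P w β c) ∧
      ((M.guided.step P w β c).state = .accept ∨ (M.guided.step P w β c).state = .reject ∨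
        (∀ i, (M.guided.step P w β c).heads i ≤ w.length + 1) ∧
        ∑ i, c.heads i < ∑ i, (M.guided.step P w β c).heads i) := by
  rcases hs : c.state with q | q | _ | _
  · exact q.elim
  · obtain ⟨h0, hc⟩ := hc
    simp only [hs] at hc
    obtain ⟨hp, hm, hr⟩ := hc
    rw [guided_step_of_det P w β c q hs]
    generalize P w c.history (M.guided.msg (Sum.inr q)) = g
    obtain ⟨q, m⟩ := q
    simp only at hm hr
    subst hm
    by_cases ha : ∃ a ∈ M.accept,
        Relation.ReflTransGen (M.IdleStep (departed c.heads) (scan w c.heads)) q a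
    · have : M.guided.δdet (q, departed c.heads) (scan w c.heads) g = (.accept, 0) := if_pos ha
      obtain ⟨a, ha, hqa⟩ := ha
      rw [this]
      exact ⟨⟨h0, a, ha, _, hr.trans (reachable_of_idle hp hqa)⟩, Or.inl rfl⟩
    · rcases g with _ | t
      · have : M.guided.δdet (q, departed c.heads) (scan w c.heads) none = (.reject, 0) := if_neg ha
        rw [this]
        exact ⟨⟨h0, trivial⟩, Or.inr (Or.inl rfl)⟩
      · by_cases ht : ¬ Idle (departed c.heads) (scan w c.heads) t.2 ∧
            ∃ q', Relation.ReflTransGen (M.IdleStep (departed c.heads) (scan w c.heads)) q q' ∧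
              t ∈ M.δ q' (scan w c.heads)
        · have : M.guided.δdet (q, departed c.heads) (scan w c.heads) (some t) =
              (.det (t.1, fun i => departed c.heads i || decide (t.2 i = 1)), t.2) :=
            (if_neg ha).trans (if_pos ht)
          obtain ⟨hd, q', hq', ht⟩ := ht
          rw [this]
          refine ⟨⟨h0, move_le w _ _, (departed_move w _ _).symm, ?_⟩,
            Or.inr (Or.inr ⟨move_le w _ _, ?_⟩)⟩
          · exact (hr.trans (reachable_of_idle hp hq')).tail ⟨t.2, ht, rfl⟩
          · rw [idle_iff hp] at hd
            obtain ⟨i, hi⟩ := Function.ne_iff.1 hd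
            exact Finset.sum_lt_sum (fun i _ => move_mono hp _ i)
              ⟨i, Finset.mem_univ i, lt_of_le_of_ne (move_mono hp _ i) (Ne.symm hi)⟩
        · have : M.guided.δdet (q, departed c.heads) (scan w c.heads) (some t) = (.reject, 0) :=
            (if_neg ha).trans (if_neg ht)
          rw [this]
          exact ⟨⟨h0, trivial⟩, Or.inr (Or.inl rfl)⟩
  · have : M.guided.step P w β c = c := by simp only [Verifier.step, hs]
    rw [this]
    exact ⟨hc, Or.inl hs⟩
  · have : M.guided.step P w β c = c := by simp only [Verifier.step, hs]
    rw [this]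
    exact ⟨hc, Or.inr (Or.inl hs)⟩

theorem guidedInv_run (P : Prover α M.guided.Γ) (w : List α) (β : ℕ → Bool) (n : ℕ) :
    M.GuidedInv w (M.guided.run P w β n) := by
  induction n with
  | zero => exact ⟨rfl, fun i => Nat.zero_le _, by funext i; simp [departed, Verifier.run,
      Verifier.init], Relation.ReflTransGen.refl⟩
  | succ n ih =>
    rw [Verifier.run, Function.iterate_succ_apply']
    exact (guided_step P w β _ ih).1

theorem guided_halts (P : Prover α M.guided.Γ) (w : List α) (β : ℕ → Bool) :
    ∃ n, (M.guided.run P w β n).state = .accept ∨ (M.guided.run P w β n).state = .reject := by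
  by_contra! h
  -- Each step without halting raises the sum of the head positions, which cannot exceed `k *
  -- (w.length + 1)`.
  have key : ∀ n, (∀ i, (M.guided.run P w β n).heads i ≤ w.length + 1) ∧
      n ≤ ∑ i, (M.guided.run P w β n).heads i := by
    intro n
    induction n with
    | zero => exact ⟨fun i => Nat.zero_le _, Nat.zero_le _⟩
    | succ n ih =>
      have h1 := (guided_step P w β _ (guidedInv_run P w β n)).2
      have h2 := h (n + 1)
      have h3 : M.guided.run P w β (n + 1) = M.guided.step P w β (M.guided.run P w β n) := by
        rw [Verifier.run, Function.iterate_succ_apply']; rfl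
      rw [h3] at h2 ⊢
      rcases h1 with h1 | h1 | h1
      · exact absurd h1 h2.1
      · exact absurd h1 h2.2
      · exact ⟨h1.1, by omega⟩
  obtain ⟨h1, h2⟩ := key (k * (w.length + 1) + 1)
  have h3 := Finset.sum_le_card_nsmul Finset.univ
    (fun i => (M.guided.run P w β (k * (w.length + 1) + 1)).heads i) _ fun i _ => h1 i
  simp only [Finset.card_univ, Fintype.card_fin, smul_eq_mul] at h3
  omega

/-- Induction along the computation from its front. The verifier's state `q` may lag behind the
automaton's state by idle transitions, which are absorbed until a head moves. The responses are
fixed from index `N` on, independently of what came before, so that they can be chosen back to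
front. -/
theorem exists_responses {w : List α} {x y : M.Q × (Fin k → ℕ)}
    (h : Relation.ReflTransGen (M.Step w) x y) (hy : y.1 ∈ M.accept) :
    ∀ (_ : ∀ i, x.2 i ≤ w.length + 1) (q : M.Q)
      (_ : Relation.ReflTransGen (M.IdleStep (departed x.2) (scan w x.2)) q x.1) (N : ℕ),
      ∃ g : ℕ → M.guided.Γ, ∀ (P : Prover α M.guided.Γ) (β : ℕ → Bool) (c : M.guided.Snapshot),
        c.state = .det (q, departed x.2) → c.heads = x.2 → c.history.length = N →
        (∀ h s, N ≤ h.length → P w h s = g h.length) →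
        ∃ n, ((M.guided.step P w β)^[n] c).state = .accept := by
  have now : ∀ (x : M.Q × (Fin k → ℕ)) (q : M.Q), (∃ a ∈ M.accept,
      Relation.ReflTransGen (M.IdleStep (departed x.2) (scan w x.2)) q a) →
      ∀ (P : Prover α M.guided.Γ) (β : ℕ → Bool) (c : M.guided.Snapshot),
        c.state = .det (q, departed x.2) → c.heads = x.2 →
        ∃ n, ((M.guided.step P w β)^[n] c).state = .accept := by
    intro x q hx P β c hc hh
    refine ⟨1, ?_⟩
    rw [Function.iterate_one, guided_step_of_det P w β c _ hc, hh]
    exact congrArg Prod.fst (if_pos hx)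
  induction h using Relation.ReflTransGen.head_induction_on with
  | refl =>
    intro _ q hq N
    exact ⟨fun _ => none, fun P β c hc hh _ _ => now y q ⟨_, hy, hq⟩ P β c hc hh⟩
  | @head x z hxz _ ih =>
    intro hp q hq N
    obtain ⟨z, p⟩ := z
    obtain ⟨d, hd, hz⟩ := hxz
    simp only at hd hz
    by_cases hi : Idle (departed x.2) (scan w x.2) d
    · have h1 : p = x.2 := hz.trans ((idle_iff hp d).1 hi)
      subst h1
      exact ih hp q (hq.tail ⟨d, hi, hd⟩) N
    · subst hz
      -- Here the verifier accepts before looking at the response, so no transition needs to be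
      -- dictated.
      by_cases ha : ∃ a ∈ M.accept,
          Relation.ReflTransGen (M.IdleStep (departed x.2) (scan w x.2)) q a
      · exact ⟨fun _ => none, fun P β c hc hh _ _ => now x q ha P β c hc hh⟩
      obtain ⟨g, hg⟩ := ih (move_le w _ _) z .refl (N + 1)
      refine ⟨fun i => if i = N then some (z, d) else g i, fun P β c hc hh hN hP => ?_⟩
      have hresp : P w c.history (M.guided.msg (Sum.inr (q, departed x.2))) = some (z, d) :=
        (hP _ _ hN.ge).trans (if_pos hN)
      have hδ : M.guided.δdet (q, departed x.2) (scan w x.2) (some (z, d)) =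
          (.det (z, fun i => departed x.2 i || decide (d i = 1)), d) :=
        (if_neg ha).trans (if_pos ⟨hi, _, hq, hd⟩)
      obtain ⟨n, hn⟩ := hg P β (M.guided.step P w β c)
        (by rw [guided_step_of_det P w β c _ hc, hresp, hh, hδ, departed_move])
        (by rw [guided_step_of_det P w β c _ hc, hresp, hh, hδ])
        (by rw [guided_step_of_det P w β c _ hc, List.length_append, hN]; rfl)
        (fun h s hl => (hP h s (by omega)).trans (if_neg (by omega)))
      exact ⟨n + 1, by rwa [Function.iterate_succ_apply]⟩

end OneWayNFA

instance : IsProbabilityMeasure coinMeasure := by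
  unfold coinMeasure
  infer_instance

theorem classOneNFA_subset_verifiable (α : Type*) (comm : Communication) (crit : Criterion)
    {k : ℕ} (hk : 1 ≤ k) : classOneNFA α k ⊆ verifiable comm crit α := by
  rintro _ ⟨M, rfl⟩
  refine ⟨k, hk, M.guided, 0, fun w P β n => (OneWayNFA.guidedInv_run P w β n).1.le,
    0, le_rfl, by norm_num, ?_, fun w hw P _ => ?_⟩
  · have : Nonempty M.guided.Γ := ⟨M.guided.null⟩
    have : ∀ w ∈ M.language, ∃ g : ℕ → M.guided.Γ, ∀ (P : Prover α M.guided.Γ) (β : ℕ → Bool),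
        (∀ h s, P w h s = g h.length) → ∃ n, (M.guided.run P w β n).state = .accept := by
      rintro w ⟨q, hq, p, hqp⟩
      obtain ⟨g, hg⟩ := OneWayNFA.exists_responses hqp hq (fun i => Nat.zero_le _) _ .refl 0
      refine ⟨g, fun P β hP => hg P β M.guided.init ?_ rfl rfl fun h s _ => hP h s⟩
      simp only [Verifier.init, OneWayNFA.guided, Sum.elim_inr]
      congr 2
    choose! g hg using this
    refine ⟨fun w h _ => g w h.length, ?_, fun w hw => ?_⟩
    · cases comm
      · exact ⟨g, fun _ _ _ => rfl⟩
      · trivial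
    · have h1 : {β | ∃ n, (M.guided.run (fun w h _ => g w h.length) w β n).state = .accept} =
          Set.univ := Set.eq_univ_of_forall fun β => hg w hw _ β fun _ _ => rfl
      rw [Verifier.acceptProb, h1]
      simp
  · have hno : ∀ β n, (M.guided.run P w β n).state ≠ .accept := by
      intro β n h
      have := (OneWayNFA.guidedInv_run P w β n).2
      rw [h] at this
      exact hw this
    cases crit
    · have h1 : {β | ∃ n, (M.guided.run P w β n).state = .reject} = Set.univ :=
        Set.eq_univ_of_forall fun β =>
          (OneWayNFA.guided_halts P w β).imp fun n h => h.resolve_left (hno β n)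
      rw [Criterion.Sound, Verifier.rejectProb, h1]
      simp
    · have h1 : {β | ∃ n, (M.guided.run P w β n).state = .accept} = ∅ :=
        Set.eq_empty_of_forall_notMem fun β ⟨n, h⟩ => hno β n h
      rw [Criterion.Sound, Verifier.acceptProb, h1]
      simp


/-! ### The probability of acceptance, with a bounded number of coin tosses -/

theorem coinMeasure_real_prefix (m : ℕ) (x : Fin m → Bool) :
    coinMeasure.real {β | (fun i : Fin m => β i) = x} = (1 / 2) ^ m := by
  have h : {β : ℕ → Bool | (fun i : Fin m => β i) = x} =
      -- The cylinder as a box over finitely many coordinates; the value `∅` is never taken there.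
      Set.pi (Finset.range m) fun j => if hj : j < m then {x ⟨j, hj⟩} else ∅ := by
    ext β
    simp only [Set.mem_ofPred_eq, funext_iff, Set.mem_pi, Finset.coe_range, Set.mem_Iio]
    constructor
    · intro h j hj
      rw [dif_pos hj]
      exact h ⟨j, hj⟩
    · intro h i
      have := h i i.2
      rwa [dif_pos i.2] at this
  have hc : ∀ y : Bool, (PMF.uniformOfFintype Bool).toMeasure {y} = 2⁻¹ := by
    intro y
    rw [PMF.toMeasure_apply_singleton _ _ (measurableSet_singleton y)]
    simp
  rw [Measure.real, h, coinMeasure, Measure.infinitePi_pi _ fun _ _ => .of_discrete,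
    Finset.prod_congr rfl (g := fun _ => 2⁻¹)]
  · simp
  · intro j hj
    rw [dif_pos (Finset.mem_range.1 hj), hc]

theorem measurable_prefix (m : ℕ) : Measurable fun (β : ℕ → Bool) (i : Fin m) => β i := by
  fun_prop

theorem coinMeasure_real_preimage_prefix (m : ℕ) (S : Set (Fin m → Bool)) :
    coinMeasure.real {β | (fun i : Fin m => β i) ∈ S} = S.ncard * (1 / 2) ^ m := by
  classical
  have h : {β : ℕ → Bool | (fun i : Fin m => β i) ∈ S} =
      ⋃ x ∈ S.toFinset, {β | (fun i : Fin m => β i) = x} := by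
    ext β
    simp
  rw [h, measureReal_biUnion_finset, Finset.sum_congr rfl fun x _ => coinMeasure_real_prefix m x,
    Finset.sum_const, nsmul_eq_mul, Set.ncard_eq_toFinset_card']
  · intro x _ y _ hxy
    exact Set.disjoint_left.2 fun β hx hy => hxy (hx.symm.trans hy)
  · exact fun x _ => measurable_prefix m (measurableSet_singleton x)

/-- The periodic sequence with the period `b`. -/
def periodic {r : ℕ} (b : Fin (r + 1) → Bool) : ℕ → Bool := fun j => b (Fin.ofNat (r + 1) j)

namespace Verifier

variable {α : Type*} {k : ℕ} {V : Verifier α k}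

theorem run_succ (P : Prover α V.Γ) (w : List α) (β : ℕ → Bool) (n : ℕ) :
    V.run P w β (n + 1) = V.step P w β (V.run P w β n) :=
  Function.iterate_succ_apply' _ _ _

/-- A step consults only the bit with index `tossed`, which is at most `r`. Keeping `r + 1` bits
covers this index without asking whether another coin is tossed, and keeps the index set nonempty
when `r = 0`. -/
theorem UsesAtMost.run_congr {r : ℕ} (hV : V.UsesAtMost r) (P : Prover α V.Γ) (w : List α)
    {β β' : ℕ → Bool} (h : ∀ j ≤ r, β j = β' j) (n : ℕ) : V.run P w β n = V.run P w β' n := by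
  induction n with
  | zero => rfl
  | succ n ih =>
    rw [run_succ, run_succ, ← ih]
    have := h _ (hV w P β n)
    simp only [step, this]

theorem UsesAtMost.run_periodic {r : ℕ} (hV : V.UsesAtMost r) (P : Prover α V.Γ) (w : List α)
    (β : ℕ → Bool) (n : ℕ) :
    V.run P w (periodic fun i : Fin (r + 1) => β i) n = V.run P w β n := by
  refine hV.run_congr P w (fun j hj => ?_) n
  rw [periodic, Fin.val_ofNat, Nat.mod_eq_of_lt (by omega)]

theorem UsesAtMost.setOf_state_eq {r : ℕ} (hV : V.UsesAtMost r) (P : Prover α V.Γ) (w : List α)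
    (s : VState V.R V.D) :
    {β | ∃ n, (V.run P w β n).state = s} =
      {β | (fun i : Fin (r + 1) => β i) ∈ {b | ∃ n, (V.run P w (periodic b) n).state = s}} := by
  ext β
  simp only [Set.mem_ofPred_eq, hV.run_periodic]

theorem UsesAtMost.acceptProb_eq {r : ℕ} (hV : V.UsesAtMost r) (P : Prover α V.Γ) (w : List α) :
    V.acceptProb P w =
      {b : Fin (r + 1) → Bool | ∃ n, (V.run P w (periodic b) n).state = .accept}.ncard *
        (1 / 2) ^ (r + 1) := by
  rw [acceptProb, hV.setOf_state_eq, coinMeasure_real_preimage_prefix]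

theorem run_add_of_halted (P : Prover α V.Γ) (w : List α) (β : ℕ → Bool) {n : ℕ}
    (h : (V.run P w β n).state = .accept ∨ (V.run P w β n).state = .reject) (m : ℕ) :
    V.run P w β (n + m) = V.run P w β n := by
  induction m with
  | zero => rfl
  | succ m ih =>
    rw [← Nat.add_assoc, run_succ, ih]
    rcases h with h | h <;> simp only [step, h]

theorem run_state_ne_reject {P : Prover α V.Γ} {w : List α} {β : ℕ → Bool} {n : ℕ}
    (hn : (V.run P w β n).state = .accept) (m : ℕ) : (V.run P w β m).state ≠ .reject := by
  intro hm
  have h1 := run_add_of_halted P w β (Or.inl hn) m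
  have h2 := run_add_of_halted P w β (Or.inr hm) n
  rw [Nat.add_comm, h1] at h2
  rw [← h2, hn] at hm
  cases hm

/-- The two events are disjoint because halting states are never left; measurability comes from the
dependence on finitely many bits. -/
theorem UsesAtMost.acceptProb_add_rejectProb_le {r : ℕ} (hV : V.UsesAtMost r)
    (P : Prover α V.Γ) (w : List α) : V.acceptProb P w + V.rejectProb P w ≤ 1 := by
  rw [acceptProb, rejectProb, ← measureReal_union]
  · exact measureReal_le_one
  · exact Set.disjoint_left.2 fun β ⟨n, hn⟩ ⟨m, hm⟩ => run_state_ne_reject hn m hm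
  · rw [hV.setOf_state_eq]
    exact measurable_prefix _ (MeasurableSet.of_discrete)

theorem UsesAtMost.acceptProb_le_of_sound {r : ℕ} (hV : V.UsesAtMost r) {crit : Criterion}
    {ε : ℝ} {P : Prover α V.Γ} {w : List α} (h : crit.Sound V ε P w) : V.acceptProb P w ≤ ε := by
  cases crit
  · have h1 := hV.acceptProb_add_rejectProb_le P w
    have h2 : 1 - ε ≤ V.rejectProb P w := h
    linarith
  · exact h

end Verifier

/-! ### From verifiers to automata -/

namespace VState

variable {R D : Type}

instance [Finite R] [Finite D] : Finite (VState R D) := by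
  refine Finite.of_surjective (α := (R ⊕ D) ⊕ Bool)
    (Sum.elim (Sum.elim coin det) fun b => if b then accept else reject) fun s => ?_
  rcases s with q | q | _ | _
  · exact ⟨.inl (.inl q), rfl⟩
  · exact ⟨.inl (.inr q), rfl⟩
  · exact ⟨.inr true, rfl⟩
  · exact ⟨.inr false, rfl⟩

/-- The underlying state, unless it is a halting state. -/
def running : VState R D → Option (R ⊕ D)
  | coin q => some (.inl q)
  | det q => some (.inr q)
  | accept => none
  | reject => none

theorem running_eq_none_iff {s : VState R D} : s.running = none ↔ s = accept ∨ s = reject := by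
  cases s <;> simp [running]

end VState

/-! ### Simulating all coin outcomes in parallel -/

namespace Verifier

attribute [instance] Verifier.finR Verifier.finD Verifier.finΓ

variable {α : Type*} {k : ℕ} {V : Verifier α k} {r : ℕ}

/-- The state of one of the parallel simulations of `V`: the state of `V` and the number of coins
tossed so far, modulo the number of available coins. -/
abbrev Sim (V : Verifier α k) (r : ℕ) : Type := VState V.R V.D × Fin (r + 1)

/-- The transition of a simulation with the coins `b`, after the response `g`. -/
def simNext (b : Fin (r + 1) → Bool) (ℓ : V.Sim r) (s : Fin k → Option α) (g : V.Γ) :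
    V.Sim r × (Fin k → Fin 2) :=
  match ℓ.1 with
  | .coin q => (((V.δcoin q s g (b ℓ.2)).1, ℓ.2 + 1), (V.δcoin q s g (b ℓ.2)).2)
  | .det q => (((V.δdet q s g).1, ℓ.2), (V.δdet q s g).2)
  | .accept => (ℓ, 0)
  | .reject => (ℓ, 0)

/-- The simulation is about to make a move without communication. -/
def Silent (ℓ : V.Sim r) : Prop := ∃ q, ℓ.1.running = some q ∧ V.msg q = V.null

/-- The simulation is about to send the symbol `m`. -/
def Sends (ℓ : V.Sim r) (m : V.Γ) : Prop :=
  m ≠ V.null ∧ ∃ q, ℓ.1.running = some q ∧ V.msg q = m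

theorem Sends.unique {ℓ : V.Sim r} {m m' : V.Γ} (h : V.Sends ℓ m) (h' : V.Sends ℓ m') :
    m = m' := by
  obtain ⟨-, q, hq, rfl⟩ := h
  obtain ⟨-, q', hq', rfl⟩ := h'
  rw [hq] at hq'
  rw [Option.some_inj.1 hq']

theorem Sends.not_silent {ℓ : V.Sim r} {m : V.Γ} (h : V.Sends ℓ m) : ¬ V.Silent ℓ := by
  rintro ⟨q', hq', h0⟩
  obtain ⟨h1, q, hq, rfl⟩ := h
  rw [hq] at hq'
  rw [Option.some_inj.1 hq'] at h1
  exact h1 h0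

theorem halted_or_silent_or_sends (ℓ : V.Sim r) :
    ℓ.1 = .accept ∨ ℓ.1 = .reject ∨ V.Silent ℓ ∨ ∃ m, V.Sends ℓ m := by
  rcases h : ℓ.1.running with _ | q
  · rcases VState.running_eq_none_iff.1 h with h | h
    · exact Or.inl h
    · exact Or.inr (Or.inl h)
  · by_cases h0 : V.msg q = V.null
    · exact Or.inr (Or.inr (Or.inl ⟨q, h, h0⟩))
    · exact Or.inr (Or.inr (Or.inr ⟨_, h0, q, h, rfl⟩))

theorem not_silent_of_halted {ℓ : V.Sim r} (h : ℓ.1 = .accept ∨ ℓ.1 = .reject) :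
    ¬ V.Silent ℓ := by
  rintro ⟨q, hq, -⟩
  rw [VState.running_eq_none_iff.2 h] at hq
  cases hq

theorem not_sends_of_halted {ℓ : V.Sim r} (h : ℓ.1 = .accept ∨ ℓ.1 = .reject) (m : V.Γ) :
    ¬ V.Sends ℓ m := by
  rintro ⟨-, q, hq, -⟩
  rw [VState.running_eq_none_iff.2 h] at hq
  cases hq

theorem simNext_of_halted {ℓ : V.Sim r} (h : ℓ.1 = .accept ∨ ℓ.1 = .reject)
    (b : Fin (r + 1) → Bool) (s : Fin k → Option α) (g : V.Γ) : V.simNext b ℓ s g = (ℓ, 0) := by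
  rcases h with h | h <;> simp only [simNext, h]

/-- The simulation that corresponds to a snapshot. -/
def Snapshot.sim (r : ℕ) (c : V.Snapshot) : V.Sim r := (c.state, Fin.ofNat (r + 1) c.tossed)

theorem ofNat_succ (n : ℕ) : Fin.ofNat (r + 1) (n + 1) = Fin.ofNat (r + 1) n + 1 := by
  ext
  simp [Fin.val_add]

theorem step_of_running (P : Prover α V.Γ) (w : List α) (b : Fin (r + 1) → Bool) (c : V.Snapshot)
    {q : V.R ⊕ V.D} (hq : c.state.running = some q) :
    (V.step P w (periodic b) c).sim r =
        (V.simNext b (c.sim r) (scan w c.heads) (V.communicate P w c.history q).1).1 ∧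
      (V.step P w (periodic b) c).heads = move w c.heads
        (V.simNext b (c.sim r) (scan w c.heads) (V.communicate P w c.history q).1).2 ∧
      (V.step P w (periodic b) c).history = (V.communicate P w c.history q).2 := by
  obtain ⟨s, p, t, h⟩ := c
  rcases s with q | q | _ | _ <;> cases hq
  · exact ⟨congrArg (Prod.mk _) (ofNat_succ t), rfl, rfl⟩
  · exact ⟨rfl, rfl, rfl⟩

theorem step_of_silent (P : Prover α V.Γ) (w : List α) (b : Fin (r + 1) → Bool) (c : V.Snapshot)
    (hc : V.Silent (c.sim r)) :
    (V.step P w (periodic b) c).sim r = (V.simNext b (c.sim r) (scan w c.heads) V.null).1 ∧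
      (V.step P w (periodic b) c).heads = move w c.heads
        (V.simNext b (c.sim r) (scan w c.heads) V.null).2 ∧
      (V.step P w (periodic b) c).history = c.history := by
  obtain ⟨q, hq, h0⟩ := hc
  have := step_of_running P w b c hq
  rwa [communicate, if_pos h0] at this

theorem step_of_sends (P : Prover α V.Γ) (w : List α) (b : Fin (r + 1) → Bool) (c : V.Snapshot)
    {m : V.Γ} (hc : V.Sends (c.sim r) m) :
    (V.step P w (periodic b) c).sim r =
        (V.simNext b (c.sim r) (scan w c.heads) (P w c.history m)).1 ∧
      (V.step P w (periodic b) c).heads = move w c.heads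
        (V.simNext b (c.sim r) (scan w c.heads) (P w c.history m)).2 ∧
      (V.step P w (periodic b) c).history = c.history ++ [(m, P w c.history m)] := by
  obtain ⟨h0, q, hq, rfl⟩ := hc
  have := step_of_running P w b c hq
  rwa [communicate, if_neg h0] at this

/-- The joint state of the simulations for all outcomes of the coin tosses, together with the
relation of having had the same communication so far. -/
abbrev Joint (V : Verifier α k) (r : ℕ) : Type :=
  ((Fin (r + 1) → Bool) → V.Sim r) × ((Fin (r + 1) → Bool) → (Fin (r + 1) → Bool) → Prop)

open Classical in
/-- The joint transition where each silent simulation makes a move, and the others wait. -/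
noncomputable def silentRound (x : V.Joint r) (s : (Fin (r + 1) → Bool) → Fin k → Option α) :
    V.Joint r × ((Fin (r + 1) → Bool) → Fin k → Fin 2) :=
  let y b := if V.Silent (x.1 b) then V.simNext b (x.1 b) (s b) V.null else (x.1 b, 0)
  ((fun b => (y b).1, x.2), fun b => (y b).2)

open Classical in
/-- The joint transition where each communicating simulation makes a move, with the responses `f`.
The silent simulations are given up. -/
noncomputable def commRound (x : V.Joint r) (s : (Fin (r + 1) → Bool) → Fin k → Option α)
    (f : (Fin (r + 1) → Bool) → V.Γ) : V.Joint r × ((Fin (r + 1) → Bool) → Fin k → Fin 2) :=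
  let y b := if V.Silent (x.1 b) then ((.reject, 0), 0) else V.simNext b (x.1 b) (s b) (f b)
  ((fun b => (y b).1, fun b b' => x.2 b b' ∧ ∀ m, V.Sends (x.1 b) m ↔ V.Sends (x.1 b') m),
    fun b => (y b).2)

/-- The responses `f` may all come from one prover of the given kind. -/
def Compatible (comm : Communication) (x : V.Joint r) (f : (Fin (r + 1) → Bool) → V.Γ) : Prop :=
  ∀ b b' m m', V.Sends (x.1 b) m → V.Sends (x.1 b') m' →
    (comm = .twoWay → x.2 b b' ∧ m = m') → f b = f b'

/-- The joint states in which most of the simulations have accepted. -/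
def MostAccept (x : V.Joint r) : Prop :=
  (1 / 2 : ℝ) < {b | (x.1 b).1 = .accept}.ncard * (1 / 2) ^ (r + 1)

/-- The joint transitions. -/
def JointStep (comm : Communication) (x : V.Joint r)
    (s : (Fin (r + 1) → Bool) → Fin k → Option α)
    (y : V.Joint r × ((Fin (r + 1) → Bool) → Fin k → Fin 2)) : Prop :=
  y = silentRound x s ∨ ∃ f, Compatible comm x f ∧ y = commRound x s f

/-- The heads of the simulations. -/
noncomputable def headEquiv (k r : ℕ) :
    (Fin (r + 1) → Bool) × Fin k ≃ Fin (Fintype.card ((Fin (r + 1) → Bool) × Fin k)) :=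
  Fintype.equivFin _

/-- The automaton that simulates `V` for all outcomes of the coin tosses, guessing the
responses of the prover. -/
noncomputable def parallel (V : Verifier α k) (comm : Communication) (r : ℕ) :
    OneWayNFA α (Fintype.card ((Fin (r + 1) → Bool) × Fin k)) where
  Q := V.Joint r
  start := (fun _ => V.init.sim r, fun _ _ => True)
  accept := {x | MostAccept x}
  δ x s := {y | JointStep comm x (fun b i => s (headEquiv k r (b, i)))
    (y.1, fun b i => y.2 (headEquiv k r (b, i)))}

/-- After `n b` steps with the coins `b` and the prover `P`, the simulations have the joint state
`x` and the head positions `p`; the running ones have had `N` communication steps. The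
simulations that have been given up are disregarded. -/
structure Represents (P : Prover α V.Γ) (w : List α) (N : ℕ) (n : (Fin (r + 1) → Bool) → ℕ)
    (x : V.Joint r) (p : (Fin (r + 1) → Bool) → Fin k → ℕ) : Prop where
  heads_le : ∀ b i, p b i ≤ w.length + 1
  sim_eq : ∀ b, (x.1 b).1 ≠ .reject → (V.run P w (periodic b) (n b)).sim r = x.1 b
  heads_eq : ∀ b, (x.1 b).1 ≠ .reject → (V.run P w (periodic b) (n b)).heads = p b
  length_le : ∀ b, (x.1 b).1 ≠ .reject → (V.run P w (periodic b) (n b)).history.length ≤ N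
  length_eq : ∀ b, (x.1 b).1 ≠ .accept → (x.1 b).1 ≠ .reject →
    (V.run P w (periodic b) (n b)).history.length = N
  rel_iff : ∀ b b', (x.1 b).1 ≠ .accept → (x.1 b).1 ≠ .reject →
    (x.1 b').1 ≠ .accept → (x.1 b').1 ≠ .reject →
    (x.2 b b' ↔
      (V.run P w (periodic b) (n b)).history = (V.run P w (periodic b') (n b')).history)

/-! ### Joint states as stages of the interaction with one prover -/

section Represents

variable {P P' : Prover α V.Γ} {w : List α} {N : ℕ} {n : (Fin (r + 1) → Bool) → ℕ}
  {x : V.Joint r} {p : (Fin (r + 1) → Bool) → Fin k → ℕ}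

theorem represents_init (P : Prover α V.Γ) (w : List α) (comm : Communication) :
    Represents P w 0 (fun _ => 0) (V.parallel comm r).start (fun _ _ => 0) where
  heads_le _ _ := Nat.zero_le _
  sim_eq _ _ := rfl
  heads_eq _ _ := rfl
  length_le _ _ := le_rfl
  length_eq _ _ _ := rfl
  rel_iff _ _ _ _ _ _ := iff_of_true trivial rfl

theorem move_zero {w : List α} {p : Fin k → ℕ} (hp : ∀ i, p i ≤ w.length + 1) :
    move w p 0 = p := funext fun i => min_eq_left (hp i)

theorem not_halted_of_silent {ℓ : V.Sim r} (h : V.Silent ℓ) :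
    ℓ.1 ≠ .accept ∧ ℓ.1 ≠ .reject :=
  ⟨fun h' => not_silent_of_halted (Or.inl h') h, fun h' => not_silent_of_halted (Or.inr h') h⟩

theorem not_halted_of_sends {ℓ : V.Sim r} {m : V.Γ} (h : V.Sends ℓ m) :
    ℓ.1 ≠ .accept ∧ ℓ.1 ≠ .reject :=
  ⟨fun h' => not_sends_of_halted (Or.inl h') m h, fun h' => not_sends_of_halted (Or.inr h') m h⟩

open Classical in
/-- The number of steps after `silentRound`. -/
noncomputable def silentCount (x : V.Joint r) (n : (Fin (r + 1) → Bool) → ℕ) :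
    (Fin (r + 1) → Bool) → ℕ :=
  fun b => if V.Silent (x.1 b) then n b + 1 else n b

open Classical in
/-- The number of steps after `commRound`. -/
noncomputable def commCount (x : V.Joint r) (n : (Fin (r + 1) → Bool) → ℕ) :
    (Fin (r + 1) → Bool) → ℕ :=
  fun b => if ∃ m, V.Sends (x.1 b) m then n b + 1 else n b

theorem Represents.run_silentCount (h : Represents P w N n x p) {b : Fin (r + 1) → Bool}
    (hb : (x.1 b).1 ≠ .reject) :
    (V.run P w (periodic b) (silentCount x n b)).sim r =
        (silentRound x fun b => scan w (p b)).1.1 b ∧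
      (V.run P w (periodic b) (silentCount x n b)).heads =
        move w (p b) ((silentRound x fun b => scan w (p b)).2 b) ∧
      (V.run P w (periodic b) (silentCount x n b)).history =
        (V.run P w (periodic b) (n b)).history := by
  by_cases hs : V.Silent (x.1 b)
  · simp only [silentRound, silentCount, if_pos hs]
    have hsim := h.sim_eq b hb
    have hheads := h.heads_eq b hb
    rw [← hsim] at hs
    have := step_of_silent P w b _ hs
    rwa [← run_succ, hsim, hheads] at this
  · simp only [silentRound, silentCount, if_neg hs]
    exact ⟨h.sim_eq b hb, by rw [h.heads_eq b hb, move_zero (h.heads_le b)], trivial⟩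

theorem silentRound_of_halted {b : Fin (r + 1) → Bool}
    (hb : (x.1 b).1 = .accept ∨ (x.1 b).1 = .reject)
    (s : (Fin (r + 1) → Bool) → Fin k → Option α) :
    (silentRound x s).1.1 b = x.1 b := by
  simp only [silentRound, if_neg (not_silent_of_halted hb)]

theorem Represents.after_silentRound (h : Represents P w N n x p) :
    Represents P w N (silentCount x n) (silentRound x fun b => scan w (p b)).1
      (fun b => move w (p b) ((silentRound x fun b => scan w (p b)).2 b)) := by
  have hr : ∀ b, ((silentRound x fun b => scan w (p b)).1.1 b).1 ≠ .reject →
      (x.1 b).1 ≠ .reject := fun b hb hx => hb (by rw [silentRound_of_halted (Or.inr hx), hx])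
  have ha : ∀ b, ((silentRound x fun b => scan w (p b)).1.1 b).1 ≠ .accept →
      (x.1 b).1 ≠ .accept := fun b hb hx => hb (by rw [silentRound_of_halted (Or.inl hx), hx])
  constructor
  · exact fun b i => move_le _ _ _ _
  · exact fun b hb => (h.run_silentCount (hr b hb)).1
  · exact fun b hb => (h.run_silentCount (hr b hb)).2.1
  · intro b hb
    rw [(h.run_silentCount (hr b hb)).2.2]
    exact h.length_le b (hr b hb)
  · intro b hb hb'
    rw [(h.run_silentCount (hr b hb')).2.2]
    exact h.length_eq b (ha b hb) (hr b hb')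
  · intro b b' h1 h2 h3 h4
    rw [(h.run_silentCount (hr b h2)).2.2, (h.run_silentCount (hr b' h4)).2.2]
    exact h.rel_iff b b' (ha b h1) (hr b h2) (ha b' h3) (hr b' h4)

theorem Represents.run_commCount_of_sends (h : Represents P w N n x p)
    {f : (Fin (r + 1) → Bool) → V.Γ}
    (hf : ∀ b m, V.Sends (x.1 b) m → f b = P w (V.run P w (periodic b) (n b)).history m)
    {b : Fin (r + 1) → Bool} {m : V.Γ} (hs : V.Sends (x.1 b) m) :
    (V.run P w (periodic b) (commCount x n b)).sim r =
        (commRound x (fun b => scan w (p b)) f).1.1 b ∧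
      (V.run P w (periodic b) (commCount x n b)).heads =
        move w (p b) ((commRound x (fun b => scan w (p b)) f).2 b) ∧
      (V.run P w (periodic b) (commCount x n b)).history =
        (V.run P w (periodic b) (n b)).history ++
          [(m, P w (V.run P w (periodic b) (n b)).history m)] := by
  have h2 : ∃ m, V.Sends (x.1 b) m := ⟨m, hs⟩
  have hh := not_halted_of_sends hs
  simp only [commRound, commCount, if_neg hs.not_silent, if_pos h2, hf b m hs]
  have hsim := h.sim_eq b hh.2
  have hheads := h.heads_eq b hh.2
  rw [← hsim] at hs
  have := step_of_sends P w b _ hs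
  rwa [← run_succ, hsim, hheads] at this

theorem commRound_of_halted {b : Fin (r + 1) → Bool}
    (hb : (x.1 b).1 = .accept ∨ (x.1 b).1 = .reject)
    (s : (Fin (r + 1) → Bool) → Fin k → Option α) (f : (Fin (r + 1) → Bool) → V.Γ) :
    (commRound x s f).1.1 b = x.1 b ∧ (commRound x s f).2 b = 0 := by
  simp only [commRound, if_neg (not_silent_of_halted hb), simNext_of_halted hb, and_self]

theorem Represents.after_commRound (h : Represents P w N n x p) {f : (Fin (r + 1) → Bool) → V.Γ}
    (hf : ∀ b m, V.Sends (x.1 b) m → f b = P w (V.run P w (periodic b) (n b)).history m) :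
    Represents P w (N + 1) (commCount x n) (commRound x (fun b => scan w (p b)) f).1
      (fun b => move w (p b) ((commRound x (fun b => scan w (p b)) f).2 b)) := by
  have hcase : ∀ b, ((commRound x (fun b => scan w (p b)) f).1.1 b).1 ≠ .reject →
      (x.1 b).1 = .accept ∨ ∃ m, V.Sends (x.1 b) m := by
    intro b hb
    rcases halted_or_silent_or_sends (x.1 b) with hs | hs | hs | hs
    · exact Or.inl hs
    · exact absurd (by rw [(commRound_of_halted (Or.inr hs) _ _).1, hs]) hb
    · simp only [commRound, if_pos hs] at hb
      exact absurd rfl hb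
    · exact Or.inr hs
  have hsends : ∀ b, ((commRound x (fun b => scan w (p b)) f).1.1 b).1 ≠ .accept →
      ((commRound x (fun b => scan w (p b)) f).1.1 b).1 ≠ .reject → ∃ m, V.Sends (x.1 b) m :=
    fun b h1 h2 => (hcase b h2).resolve_left
      fun hs => h1 (by rw [(commRound_of_halted (Or.inl hs) _ _).1, hs])
  have hacc : ∀ b, (x.1 b).1 = .accept → (x.1 b).1 ≠ .reject ∧ commCount x n b = n b := by
    intro b hs
    have h2 : ¬ ∃ m, V.Sends (x.1 b) m := fun ⟨m, hm⟩ => not_sends_of_halted (Or.inl hs) m hm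
    exact ⟨by rw [hs]; nofun, if_neg h2⟩
  constructor
  · exact fun b i => move_le _ _ _ _
  · intro b hb
    rcases hcase b hb with hs | ⟨m, hs⟩
    · rw [(hacc b hs).2, (commRound_of_halted (Or.inl hs) _ _).1, h.sim_eq b (hacc b hs).1]
    · exact (h.run_commCount_of_sends hf hs).1
  · intro b hb
    rcases hcase b hb with hs | ⟨m, hs⟩
    · rw [(hacc b hs).2, (commRound_of_halted (Or.inl hs) _ _).2, h.heads_eq b (hacc b hs).1,
        move_zero (h.heads_le b)]
    · exact (h.run_commCount_of_sends hf hs).2.1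
  · intro b hb
    rcases hcase b hb with hs | ⟨m, hs⟩
    · rw [(hacc b hs).2]
      exact (h.length_le b (hacc b hs).1).trans (Nat.le_succ N)
    · rw [(h.run_commCount_of_sends hf hs).2.2, List.length_append]
      exact Nat.succ_le_succ (h.length_le b (not_halted_of_sends hs).2)
  · intro b h1 h2
    obtain ⟨m, hs⟩ := hsends b h1 h2
    rw [(h.run_commCount_of_sends hf hs).2.2, List.length_append,
      h.length_eq b (not_halted_of_sends hs).1 (not_halted_of_sends hs).2]
    rfl
  · intro b b' h1 h2 h3 h4
    obtain ⟨m, hs⟩ := hsends b h1 h2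
    obtain ⟨m', hs'⟩ := hsends b' h3 h4
    rw [(h.run_commCount_of_sends hf hs).2.2, (h.run_commCount_of_sends hf hs').2.2,
      List.append_singleton_inj, Prod.mk.injEq]
    have hh := not_halted_of_sends hs
    have hh' := not_halted_of_sends hs'
    -- The responses need no comparison of their own: after equal histories and equal symbols sent,
    -- one prover gives equal responses.
    refine (and_congr (h.rel_iff b b' hh.1 hh.2 hh'.1 hh'.2)
      (b := ∀ m, V.Sends (x.1 b) m ↔ V.Sends (x.1 b') m) (d := m = m')
      ⟨fun h => ((h m).1 hs).unique hs', ?_⟩).trans ?_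
    · rintro rfl m'
      exact ⟨fun h => h.unique hs ▸ hs', fun h => h.unique hs' ▸ hs⟩
    · exact and_congr_right fun e => ⟨fun e' => ⟨e', by rw [e, e']⟩, And.left⟩

theorem length_history_mono (P : Prover α V.Γ) (w : List α) (β : ℕ → Bool) (n : ℕ) :
    (V.run P w β n).history.length ≤ (V.run P w β (n + 1)).history.length := by
  rw [run_succ]
  rcases h : (V.run P w β n).state <;> simp only [step, h, communicate, le_refl] <;> split_ifs <;>
    simp

/-- A run with at most `N` communication steps has consulted the prover only at histories shorter
than `N`. Responses at length `N` can therefore still be altered freely. -/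
theorem run_congr_prover {β : ℕ → Bool}
    (hP : ∀ h s, h.length < N → P' w h s = P w h s) {n : ℕ}
    (hn : (V.run P w β n).history.length ≤ N) : V.run P' w β n = V.run P w β n := by
  induction n with
  | zero => rfl
  | succ n ih =>
    have ih := ih ((length_history_mono P w β n).trans hn)
    rw [run_succ] at hn
    rw [run_succ, run_succ, ih]
    have : ∀ q, (V.communicate P w (V.run P w β n).history q).2.length ≤ N →
        V.communicate P' w (V.run P w β n).history q =
          V.communicate P w (V.run P w β n).history q := by
      intro q hq
      by_cases h0 : V.msg q = V.null
      · simp only [communicate, if_pos h0]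
      · simp only [communicate, if_neg h0, List.length_append, List.length_singleton] at hq ⊢
        rw [hP _ _ (by omega)]
    rcases hs : (V.run P w β n).state with q | q | _ | _
    all_goals
      simp only [step, hs] at hn ⊢
    all_goals
      rw [this _ hn]

theorem Represents.congr_prover (h : Represents P w N n x p)
    (hP : ∀ h s, h.length < N → P' w h s = P w h s) : Represents P' w N n x p := by
  have key : ∀ b, (x.1 b).1 ≠ .reject →
      V.run P' w (periodic b) (n b) = V.run P w (periodic b) (n b) :=
    fun b hb => run_congr_prover hP (h.length_le b hb)
  constructor
  · exact h.heads_le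
  · exact fun b hb => key b hb ▸ h.sim_eq b hb
  · exact fun b hb => key b hb ▸ h.heads_eq b hb
  · exact fun b hb => key b hb ▸ h.length_le b hb
  · exact fun b ha hb => key b hb ▸ h.length_eq b ha hb
  · intro b b' ha hb ha' hb'
    rw [key b hb, key b' hb']
    exact h.rel_iff b b' ha hb ha' hb'

/-- Compatible guesses are the responses of some prover that has behaved like `P` so far. -/
theorem Represents.exists_prover (h : Represents P w N n x p) {comm : Communication}
    (hP : P ∈ comm.provers α V.Γ) {f : (Fin (r + 1) → Bool) → V.Γ} (hf : Compatible comm x f) :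
    ∃ P' ∈ comm.provers α V.Γ, Represents P' w N n x p ∧
      ∀ b m, V.Sends (x.1 b) m → f b = P' w (V.run P' w (periodic b) (n b)).history m := by
  classical
  suffices ∃ P' ∈ comm.provers α V.Γ, (∀ h s, h.length < N → P' w h s = P w h s) ∧
      ∀ b m, V.Sends (x.1 b) m → f b = P' w (V.run P w (periodic b) (n b)).history m by
    obtain ⟨P', h1, h2, h3⟩ := this
    refine ⟨P', h1, h.congr_prover h2, fun b m hs => ?_⟩
    rw [run_congr_prover h2 (h.length_le b (not_halted_of_sends hs).2)]
    exact h3 b m hs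
  have hlen : ∀ b m, V.Sends (x.1 b) m → (V.run P w (periodic b) (n b)).history.length = N :=
    fun b m hs => h.length_eq b (not_halted_of_sends hs).1 (not_halted_of_sends hs).2
  cases comm
  · obtain ⟨c, hc⟩ := hP
    -- Compatibility makes all sending simulations share one guess, which becomes entry `N` of the
    -- sequence. If none sends, `P` itself will do.
    by_cases hex : ∃ b m, V.Sends (x.1 b) m
    · obtain ⟨b₀, m₀, hs₀⟩ := hex
      refine ⟨fun w h _ => if h.length = N then f b₀ else c w h.length,
        ⟨fun w i => if i = N then f b₀ else c w i, fun _ _ _ => rfl⟩, fun h s hl => ?_,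
        fun b m hs => ?_⟩
      · rw [hc]
        exact if_neg hl.ne
      · exact (hf b b₀ m m₀ hs hs₀ nofun).trans (if_pos (hlen b m hs)).symm
    · exact ⟨P, ⟨c, hc⟩, fun _ _ _ => rfl, fun b m hs => absurd ⟨b, m, hs⟩ hex⟩
  -- Several simulations may share the history and the symbol sent; compatibility makes the choice
  -- among them immaterial.
  · refine ⟨fun w' h s => if hb : ∃ b, V.Sends (x.1 b) s ∧
        (V.run P w (periodic b) (n b)).history = h then f hb.choose else P w' h s,
      trivial, fun h s hl => ?_, fun b m hs => ?_⟩
    · refine dif_neg ?_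
      rintro ⟨b, hs, rfl⟩
      exact hl.ne (hlen b s hs)
    · have hb : ∃ b', V.Sends (x.1 b') m ∧ (V.run P w (periodic b') (n b')).history =
          (V.run P w (periodic b) (n b)).history := ⟨b, hs, rfl⟩
      refine Eq.trans ?_ (dif_pos hb).symm
      obtain ⟨hs', he⟩ := hb.choose_spec
      have hh := not_halted_of_sends hs
      have hh' := not_halted_of_sends hs'
      exact hf b _ m m hs hs' fun _ =>
        ⟨(h.rel_iff b _ hh.1 hh.2 hh'.1 hh'.2).2 he.symm, rfl⟩

/-- The responses of a prover are compatible. -/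
theorem Represents.compatible (h : Represents P w N n x p) {comm : Communication}
    (hP : P ∈ comm.provers α V.Γ) {f : (Fin (r + 1) → Bool) → V.Γ}
    (hf : ∀ b m, V.Sends (x.1 b) m → f b = P w (V.run P w (periodic b) (n b)).history m) :
    Compatible comm x f := by
  intro b b' m m' hs hs' hx
  have hh := not_halted_of_sends hs
  have hh' := not_halted_of_sends hs'
  rw [hf b m hs, hf b' m' hs']
  cases comm
  · obtain ⟨c, hc⟩ := hP
    rw [hc, hc, h.length_eq b hh.1 hh.2, h.length_eq b' hh'.1 hh'.2]
  · obtain ⟨h1, rfl⟩ := hx rfl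
    rw [(h.rel_iff b b' hh.1 hh.2 hh'.1 hh'.2).1 h1]

/-- Acceptance is permanent, so a simulation not yet accepting stands before time `T`. This makes
the remaining time in `exists_computation` positive. -/
theorem Represents.lt_of_not_accept (h : Represents P w N n x p) {b : Fin (r + 1) → Bool}
    (hb : (x.1 b).1 ≠ .reject) (hacc : (x.1 b).1 ≠ .accept) {T : ℕ}
    (hT : (V.run P w (periodic b) T).state = .accept) : n b < T := by
  by_contra! hle
  obtain ⟨m, hm⟩ := Nat.exists_eq_add_of_le hle
  have h1 : (V.run P w (periodic b) (n b)).state = (x.1 b).1 :=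
    congrArg Prod.fst (h.sim_eq b hb)
  rw [hm, run_add_of_halted P w _ (Or.inl hT), hT] at h1
  exact hacc h1.symm

end Represents

/-! ### The language of the parallel automaton -/

theorem step_parallel_iff {comm : Communication} {w : List α} {x z : V.Joint r}
    {p p' : Fin (Fintype.card ((Fin (r + 1) → Bool) × Fin k)) → ℕ} :
    (V.parallel comm r).Step w (x, p) (z, p') ↔
      ∃ v, JointStep comm x (fun b => scan w fun i => p (headEquiv k r (b, i))) v ∧ v.1 = z ∧
        (fun b i => p' (headEquiv k r (b, i))) =
          fun b => move w (fun i => p (headEquiv k r (b, i))) (v.2 b) := by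
  constructor
  · rintro ⟨d, hd, hp'⟩
    refine ⟨_, hd, rfl, ?_⟩
    have hp' : p' = move w p d := hp'
    rw [hp']
    rfl
  · rintro ⟨v, hv, rfl, hp'⟩
    refine ⟨fun j => v.2 ((headEquiv k r).symm j).1 ((headEquiv k r).symm j).2, ?_, ?_⟩
    · change JointStep comm x _ (v.1, _)
      simp only [Equiv.symm_apply_apply]
      exact hv
    · funext j
      have := congrFun (congrFun hp' ((headEquiv k r).symm j).1) ((headEquiv k r).symm j).2
      simpa only [move, Prod.mk.eta, Equiv.apply_symm_apply] using this

/-- Any computation of the parallel automaton represents the interaction with some prover. -/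
theorem exists_represents {comm : Communication} {w : List α}
    {y : V.Joint r × (Fin (Fintype.card ((Fin (r + 1) → Bool) × Fin k)) → ℕ)}
    (hy : Relation.ReflTransGen ((V.parallel comm r).Step w)
      ((V.parallel comm r).start, fun _ => 0) y) :
    ∃ P ∈ comm.provers α V.Γ, ∃ N n,
      Represents P w N n y.1 fun b i => y.2 (headEquiv k r (b, i)) := by
  induction hy with
  | refl =>
    refine ⟨fun _ _ _ => V.null, ?_, 0, _, represents_init _ w comm⟩
    cases comm
    · exact ⟨fun _ _ => V.null, fun _ _ _ => rfl⟩
    · trivial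
  | @tail y z _ hyz ih =>
    obtain ⟨P, hP, N, n, h⟩ := ih
    obtain ⟨x, p⟩ := y
    obtain ⟨z, p'⟩ := z
    obtain ⟨v, hv, rfl, hp'⟩ := step_parallel_iff.1 hyz
    simp only [hp']
    rcases hv with rfl | ⟨f, hf, rfl⟩
    · exact ⟨P, hP, N, _, h.after_silentRound⟩
    · obtain ⟨P', hP', h, hf'⟩ := h.exists_prover hP hf
      exact ⟨P', hP', N + 1, _, h.after_commRound hf'⟩

/-- If the simulations in `S` accept in the interaction with `P`, then the parallel automaton can
follow them. -/
theorem exists_computation {comm : Communication} {P : Prover α V.Γ}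
    (hP : P ∈ comm.provers α V.Γ) {w : List α} {T : (Fin (r + 1) → Bool) → ℕ}
    {S : Finset (Fin (r + 1) → Bool)}
    (hT : ∀ b ∈ S, (V.run P w (periodic b) (T b)).state = .accept) (μ : ℕ) :
    ∀ {N : ℕ} {n : (Fin (r + 1) → Bool) → ℕ} {x : V.Joint r}
      {p : Fin (Fintype.card ((Fin (r + 1) → Bool) × Fin k)) → ℕ}
      (_ : Represents P w N n x fun b i => p (headEquiv k r (b, i)))
      (_ : ∀ b ∈ S, (x.1 b).1 ≠ .reject) (_ : ∑ b ∈ S, (T b - n b) ≤ μ),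
      ∃ y p', Relation.ReflTransGen ((V.parallel comm r).Step w) (x, p) (y, p') ∧
        ∀ b ∈ S, (y.1 b).1 = .accept := by
  classical
  induction μ with
  | zero =>
    intro N n x p h hS hμ
    refine ⟨x, p, .refl, fun b hb => ?_⟩
    by_contra hacc
    have h1 := h.lt_of_not_accept (hS b hb) hacc (hT b hb)
    have h2 := Finset.sum_eq_zero_iff.1 (Nat.le_zero.1 hμ) b hb
    omega
  | succ μ ih =>
    intro N n x p h hS hμ
    by_cases hall : ∀ b ∈ S, (x.1 b).1 = .accept
    · exact ⟨x, p, .refl, hall⟩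
    push Not at hall
    -- A joint transition that advances an unfinished simulation in `S` and rejects none in `S`
    -- lowers the total remaining time.
    have advance : ∀ (v : V.Joint r × ((Fin (r + 1) → Bool) → Fin k → Fin 2)) (N' : ℕ)
        (n' : (Fin (r + 1) → Bool) → ℕ),
        JointStep comm x (fun b => scan w fun i => p (headEquiv k r (b, i))) v →
        Represents P w N' n' v.1
          (fun b => move w (fun i => p (headEquiv k r (b, i))) (v.2 b)) →
        (∀ b ∈ S, (v.1.1 b).1 ≠ .reject) → (∀ b, n b ≤ n' b) →
        (∃ b ∈ S, (x.1 b).1 ≠ .accept ∧ n' b = n b + 1) →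
        ∃ y p', Relation.ReflTransGen ((V.parallel comm r).Step w) (x, p) (y, p') ∧
          ∀ b ∈ S, (y.1 b).1 = .accept := by
      intro v N' n' hv hrep hrej hle ⟨b, hb, hacc, hn⟩
      have hp : (fun b i => move w p (fun j => v.2 ((headEquiv k r).symm j).1
            ((headEquiv k r).symm j).2) (headEquiv k r (b, i))) =
          fun b => move w (fun i => p (headEquiv k r (b, i))) (v.2 b) := by
        funext b i
        simp only [move, Equiv.symm_apply_apply]
      have hlt : ∑ b ∈ S, (T b - n' b) < ∑ b ∈ S, (T b - n b) := by
        refine Finset.sum_lt_sum (fun b _ => Nat.sub_le_sub_left (hle b) _) ⟨b, hb, ?_⟩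
        have := h.lt_of_not_accept (hS b hb) hacc (hT b hb)
        omega
      obtain ⟨y, p', hy, hyS⟩ := ih (hp ▸ hrep) hrej (by omega)
      exact ⟨y, p', .head (step_parallel_iff.2 ⟨v, hv, rfl, hp⟩) hy, hyS⟩
    -- Silent moves come first: a communication round would give up any silent simulation in `S`.
    by_cases hsil : ∃ b ∈ S, V.Silent (x.1 b)
    · obtain ⟨b, hb, hs⟩ := hsil
      refine advance _ N _ (Or.inl rfl) h.after_silentRound (fun b hb => ?_) (fun b => ?_)
        ⟨b, hb, (not_halted_of_silent hs).1, if_pos hs⟩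
      -- The new state occurs in a run that accepts, and such a run never visits the rejecting
      -- state.
      · rw [← (h.run_silentCount (hS b hb)).1]
        exact run_state_ne_reject (hT b hb) _
      · unfold silentCount
        split_ifs <;> omega
    · have hsend : ∀ b ∈ S, (x.1 b).1 ≠ .accept → ∃ m, V.Sends (x.1 b) m := by
        intro b hb hacc
        rcases halted_or_silent_or_sends (x.1 b) with hs | hs | hs | hs
        · exact absurd hs hacc
        · exact absurd hs (hS b hb)
        · exact absurd ⟨b, hb, hs⟩ hsil
        · exact hs
      have hf : ∀ b m, V.Sends (x.1 b) m →
          -- The default is harmless: simulations that send nothing have halted or are given up.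
          (if hm : ∃ m, V.Sends (x.1 b) m then
            P w (V.run P w (periodic b) (n b)).history hm.choose else V.null) =
          P w (V.run P w (periodic b) (n b)).history m := by
        intro b m hs
        have hm : ∃ m, V.Sends (x.1 b) m := ⟨m, hs⟩
        rw [dif_pos hm, hm.choose_spec.unique hs]
      obtain ⟨b, hb, hacc⟩ := hall
      refine advance _ (N + 1) _ (Or.inr ⟨_, h.compatible hP hf, rfl⟩) (h.after_commRound hf)
        (fun b hb => ?_) (fun b => ?_) ⟨b, hb, hacc, if_pos (hsend b hb hacc)⟩
      · by_cases hacc : (x.1 b).1 = .accept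
        · rw [(commRound_of_halted (Or.inl hacc) _ _).1]
          exact hS b hb
        · obtain ⟨m, hs⟩ := hsend b hb hacc
          rw [← (h.run_commCount_of_sends hf hs).1]
          exact run_state_ne_reject (hT b hb) _
      · unfold commCount
        split_ifs <;> omega

theorem parallel_language {comm : Communication} {crit : Criterion} {L : Language α} {ε : ℝ}
    (hV : V.UsesAtMost r) (hε : ε < 1 / 2) (hL : IsProofSystem comm crit V L ε) :
    (V.parallel comm r).language = L := by
  classical
  ext w
  constructor
  · rintro ⟨x, hx, p, hp⟩
    by_contra hw
    obtain ⟨P, hP, N, n, h⟩ := exists_represents hp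
    have h1 := hV.acceptProb_le_of_sound (hL.2 w hw P hP)
    rw [hV.acceptProb_eq] at h1
    -- Accepted simulations are genuine accepting runs against the single prover `P`, so more than
    -- half of them contradicts soundness.
    have h2 : {b | (x.1 b).1 = .accept} ⊆
        {b | ∃ n, (V.run P w (periodic b) n).state = .accept} := by
      intro b hb
      have hb : (x.1 b).1 = .accept := hb
      refine ⟨n b, ?_⟩
      have h3 := h.sim_eq b (by rw [hb]; nofun)
      exact (congrArg Prod.fst h3).trans hb
    have h3 : (1 / 2 : ℝ) < {b | (x.1 b).1 = .accept}.ncard * (1 / 2) ^ (r + 1) := hx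
    have h4 := Set.ncard_le_ncard h2
    have h5 : ({b | (x.1 b).1 = .accept}.ncard : ℝ) * (1 / 2) ^ (r + 1) ≤
        {b : Fin (r + 1) → Bool | ∃ n, (V.run P w (periodic b) n).state = .accept}.ncard *
          (1 / 2) ^ (r + 1) := by
      gcongr
    linarith
  · intro hw
    obtain ⟨P, hP, h⟩ := hL.1
    have h1 := h w hw
    rw [hV.acceptProb_eq] at h1
    set A := {b : Fin (r + 1) → Bool | ∃ n, (V.run P w (periodic b) n).state = .accept} with hA
    have hT : ∀ b ∈ A, ∃ n, (V.run P w (periodic b) n).state = .accept := fun _ => id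
    choose! T hT using hT
    obtain ⟨y, p, hy, hacc⟩ := exists_computation (S := A.toFinset) hP
      (fun b hb => hT b (Set.mem_toFinset.1 hb)) _ (represents_init (r := r) P w comm)
      (p := fun _ => 0)
      (fun b _ => by
        change (V.init.sim r).1 ≠ _
        rcases hs : V.start <;> simp [Snapshot.sim, init, hs]) le_rfl
    refine ⟨y, ?_, p, hy⟩
    have h4 := Set.ncard_le_ncard (show A ⊆ {b | (y.1 b).1 = .accept} from
      fun b hb => hacc b (Set.mem_toFinset.2 hb))
    have h5 : (A.ncard : ℝ) * (1 / 2) ^ (r + 1) ≤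
        {b | (y.1 b).1 = .accept}.ncard * (1 / 2) ^ (r + 1) := by
      gcongr
    change (1 / 2 : ℝ) < _
    linarith

end Verifier
end MultiheadVerifier

theorem theorem5p3 (α : Type*) [Finite α]
    (comm : MultiheadVerifier.Communication) (crit : MultiheadVerifier.Criterion) :
    MultiheadVerifier.verifiable comm crit α =
      ⋃ (k : ℕ) (_ : 1 ≤ k), MultiheadVerifier.classOneNFA α k := by
  refine Set.Subset.antisymm ?_ (Set.iUnion₂_subset fun k hk =>
    MultiheadVerifier.classOneNFA_subset_verifiable α comm crit hk)
  rintro L ⟨k, hk, V, r, hV, ε, -, hε, hL⟩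
  refine Set.mem_iUnion₂.2 ⟨_, ?_, V.parallel comm r, V.parallel_language hV hε hL⟩
  have : Nonempty (Fin k) := ⟨⟨0, hk⟩⟩
  exact Fintype.card_pos
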